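/- Let $G$ be a finite simple graph with complement $G^c$, and let $\operatorname{mc}(G^c)$ be the number of maximal cliques of $G^c$ (equivalently, of maximal independent sets of $G$). A biclique of $G$ is an unordered pair $\{L,R\}$ of disjoint nonempty vertex sets such that every vertex of $L$ is adjacent in $G$ to every vertex of $R$; a biclique cover of $G$ is a set of bicliques such that every edge of $G$ joins the two sides of one of them; $\operatorname{bc}(G)$ is the minimum size of a biclique cover. A clique tree of $G^c$ is a tree $T$ whose vertices are the maximal cliques of $G^c$ such that every clique on the path of $T$ between $K$ and $K'$ contains $K\cap K'$. An edge-ranking of a tree $T$ with $r$ ranks is a map $\varphi:E(T)\to\{1,\dots,r\}$ such that, for any two distinct edges with the same label, the path between them contains an edge with a larger label; the optimal edge-ranking number $\chi_r'(T)$ is the smallest such $r$. Consider the following algorithm (Algorithm 3). Given $G$ with $G^c$ chordal, take a clique tree $T$ of $G^c$, an optimal edge-ranking $\varphi$ of $T$ with $r=\chi'_r(T)$ ranks, and a numbering $\sigma$ of the vertices of $T$ in the order of a breadth-first search from a leaf (in a one-vertex tree the vertex counts as a leaf). Recursively, starting from $T$: if the current subtree $S$ has more than one vertex, remove its edge $e=K_1K_2$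 with the largest label, let $S_1\ni K_1$ and $S_2\ni K_2$ be the two resulting subtrees, put $L=\bigcup_{K\in S_1}K\setminus(K_1\cap K_2)$ and $R=\bigcup_{K\in S_2}K\setminus(K_1\cap K_2)$, store $\{L,R\}$ with key $\min_{K\in S}\sigma(K)$ in the list of level $r+1-\varphi(e)$, and continue with $S_1$ and $S_2$. Then, for each level $1,\dots,r$, start with an empty collection and go through the list of the level by increasing key: replace every member $\{L',R'\}$ of the collection by $\{L\cup L',R\cup R'\}$ if this is a biclique of $G$, and otherwise by $\{R\cup L',L\cup R'\}$ if that is a biclique of $G$; if no member was replaced, add $\{L,R\}$ to the collection. Return the union of the collections of all levels. Suppose that $G$ is co-chordal (that is, $G^c$ has no induced cycle of length greater than $3$), that every vertex of $G$ lies in at most two maximal independent sets of $G$, and that $G^c$ has a clique tree $T$ with $\chi_r'(T)=\lceil\log_2 \operatorname{mc}(G^c)\rceil$. Then $$\operatorname{bc}(G)=\lceil\log_2\operatorname{mc}(G^c)\rceil .$$ Moreover, for every clique tree $T$ of $G^c$ with $\chi_r'(T)=\lceil\log_2 \operatorname{mc}(G^c)\rceil$, the algorithm has a run that uses $T$, and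 every run that uses $T$ returns a minimum biclique cover of $G$. If $G^c$ is connected, the algorithm has a run, and every run, whichever clique tree of $G^c$ it uses, returns a minimum biclique cover of $G$. -/

import Mathlib

namespace BicliqueCover

/-- A graph is chordal if it has no induced cycle of length greater than three. -/
def IsChordal {V : Type*} (G : SimpleGraph V) : Prop :=
  ∀ n : ℕ, 4 ≤ n → ¬ (SimpleGraph.cycleGraph n).IsIndContained G

/-- The maximal cliques of `G`. -/
abbrev MaxClique {V : Type*} (G : SimpleGraph V) : Type _ :=
  {K : Set V // Maximal G.IsClique K}

/-- `mc(G)`, the number of maximal cliques of `G`. -/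
noncomputable def mc {V : Type*} (G : SimpleGraph V) : ℕ :=
  Nat.card (MaxClique G)

/-- `{L, R}` is a biclique subgraph of `G`: `L` and `R` are disjoint and nonempty and every vertex
of `L` is adjacent in `G` to every vertex of `R`. -/
def IsBiclique {V : Type*} (G : SimpleGraph V) (L R : Set V) : Prop :=
  L.Nonempty ∧ R.Nonempty ∧ Disjoint L R ∧ ∀ u ∈ L, ∀ v ∈ R, G.Adj u v

/-- A biclique cover of `G`: a collection of bicliques `{L, R}` of `G` (unordered pairs) such that
every edge of `G` belongs to at least one of them. -/
def IsBicliqueCover {V : Type*} (G : SimpleGraph V) (C : Set (Sym2 (Set V))) : Prop :=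
  (∀ L R : Set V, s(L, R) ∈ C → IsBiclique G L R) ∧
    ∀ u v : V, G.Adj u v → ∃ L R : Set V, s(L, R) ∈ C ∧ u ∈ L ∧ v ∈ R

/-- `bc(G)`, the minimum size of a biclique cover of `G`. -/
noncomputable def bc {V : Type*} (G : SimpleGraph V) : ℕ :=
  sInf {k : ℕ | ∃ C : Set (Sym2 (Set V)), C.Finite ∧ IsBicliqueCover G C ∧ C.ncard = k}

/-- A minimum biclique cover of `G`. -/
def IsMinimumBicliqueCover {V : Type*} (G : SimpleGraph V) (C : Set (Sym2 (Set V))) : Prop :=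
  C.Finite ∧ IsBicliqueCover G C ∧ C.ncard = bc G

/-- A clique tree of `G`: a tree whose vertices are the maximal cliques of `G`, with the
clique-intersection property. -/
def IsCliqueTree {V : Type*} (G : SimpleGraph V) (T : SimpleGraph (MaxClique G)) : Prop :=
  T.IsTree ∧ ∀ (K₁ K₂ : MaxClique G) (p : T.Walk K₁ K₂), p.IsPath →
    ∀ K ∈ p.support, K₁.1 ∩ K₂.1 ⊆ K.1

/-- `φ` is an edge-ranking of the tree `T` with labels in `{1, …, r}`: two distinct edges with the
same label are separated by an edge with a larger label. (In a tree, the paths from an end of `e₁`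
to an end of `e₂` differ only in whether they contain `e₁` and `e₂`.) -/
def IsEdgeRanking {W : Type*} (T : SimpleGraph W) (r : ℕ) (φ : Sym2 W → ℕ) : Prop :=
  (∀ e ∈ T.edgeSet, 1 ≤ φ e ∧ φ e ≤ r) ∧
    ∀ e₁ ∈ T.edgeSet, ∀ e₂ ∈ T.edgeSet, e₁ ≠ e₂ → φ e₁ = φ e₂ →
      ∀ u ∈ e₁, ∀ v ∈ e₂, ∀ p : T.Walk u v, p.IsPath → ∃ e₃ ∈ p.edges, φ e₁ < φ e₃

/-- The optimal edge-ranking number of a tree. -/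
noncomputable def edgeRankingNumber {W : Type*} (T : SimpleGraph W) : ℕ :=
  sInf {r : ℕ | ∃ φ : Sym2 W → ℕ, IsEdgeRanking T r φ}

/-- Breadth-first search. `BFS T queue seen out` says that the search in the state with queue
`queue` and list `seen` of vertices already taken from the queue can end with the traversal order
`out`. In one step the first vertex `v` of the queue is taken, and its undiscovered neighbours are
appended to the queue, in any order. -/
inductive BFS {W : Type*} (T : SimpleGraph W) : List W → List W → List W → Prop
  | finish (out : List W) : BFS T [] out out
  | step (v : W) (queue seen new out : List W) (hnd : new.Nodup)
      (hnew : ∀ w, w ∈ new ↔ T.Adj v w ∧ w ∉ v :: queue ∧ w ∉ seen)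
      (hrest : BFS T (queue ++ new) (seen ++ [v]) out) : BFS T (v :: queue) seen out

open Classical in
/-- `σ` numbers the vertices of the tree `T`, from `1` on, in the order in which a breadth-first
search from some leaf traverses them (the only vertex of a one-vertex tree counts as a leaf). -/
def IsBFSOrdering {W : Type*} (T : SimpleGraph W) (σ : W → ℕ) : Prop :=
  ∃ (ρ : W) (out : List W), (T.neighborSet ρ).Subsingleton ∧ BFS T [ρ] [] out ∧
    ∀ w, σ w = out.idxOf w + 1

/-- The entry `({L, R}, ord)` of the lists that the algorithm keeps. -/
abbrev Entry (V : Type*) : Type _ := (Set V × Set V) × ℕ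

/-- The union of the cliques in `S`. -/
def cliqueUnion {V : Type*} {H : SimpleGraph V} (S : Set (MaxClique H)) : Set V :=
  ⋃ K ∈ S, K.1

/-- The subroutine `FindBiclique`. `FindBiclique T φ σ r S d` says that a call on the subtree of
`T` with vertex set `S` can add the entries `d i` to the list `bc[i]`, for every level `i`.
If the subtree has more than one vertex, its edge `e = K₁K₂` of largest label is removed;
`S₁` and `S₂` are the vertex sets of the two resulting subtrees. -/
inductive FindBiclique {V : Type*} {H : SimpleGraph V} (T : SimpleGraph (MaxClique H))
    (φ : Sym2 (MaxClique H) → ℕ) (σ : MaxClique H → ℕ) (r : ℕ) :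
    Set (MaxClique H) → (ℕ → List (Entry V)) → Prop
  | small (S : Set (MaxClique H)) (hS : S.Subsingleton) : FindBiclique T φ σ r S (fun _ => [])
  | cut (S S₁ S₂ : Set (MaxClique H)) (K₁ K₂ : MaxClique H) (d₁ d₂ : ℕ → List (Entry V))
      (hS : S.Nontrivial)
      (hunion : S₁ ∪ S₂ = S) (hdisj : Disjoint S₁ S₂)
      (hconn₁ : (T.induce S₁).Connected) (hconn₂ : (T.induce S₂).Connected)
      (hK₁ : K₁ ∈ S₁) (hK₂ : K₂ ∈ S₂) (hadj : T.Adj K₁ K₂)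
      (hmax : ∀ K ∈ S, ∀ K' ∈ S, T.Adj K K' → φ s(K, K') ≤ φ s(K₁, K₂))
      (h₁ : FindBiclique T φ σ r S₁ d₁) (h₂ : FindBiclique T φ σ r S₂ d₂) :
      FindBiclique T φ σ r S (fun i =>
        (if i = r + 1 - φ s(K₁, K₂) then
          [((cliqueUnion S₁ \ (K₁.1 ∩ K₂.1), cliqueUnion S₂ \ (K₁.1 ∩ K₂.1)), sInf (σ '' S))]
        else []) ++ d₁ i ++ d₂ i)

/-- `{L, R}` can be merged into `{L', R'}`, in one of the two orientations. -/
def Mergeable {V : Type*} (G : SimpleGraph V) (B B' : Set V × Set V) : Prop :=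
  IsBiclique G (B.1 ∪ B'.1) (B.2 ∪ B'.2) ∨ IsBiclique G (B.2 ∪ B'.1) (B.1 ∪ B'.2)

open Classical in
/-- The new value of `{L', R'}` when the inner loop of `MergeBiclique` compares it with
`{L, R}`. -/
noncomputable def mergeInto {V : Type*} (G : SimpleGraph V) (B B' : Set V × Set V) :
    Set V × Set V :=
  if IsBiclique G (B.1 ∪ B'.1) (B.2 ∪ B'.2) then (B.1 ∪ B'.1, B.2 ∪ B'.2)
  else if IsBiclique G (B.2 ∪ B'.1) (B.1 ∪ B'.2) then (B.2 ∪ B'.1, B.1 ∪ B'.2)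
  else B'

open Classical in
/-- One round of the outer loop of `MergeBiclique`: `{L, R}` is merged into every member of the
current collection where this is possible, and joins the collection if there is none. -/
noncomputable def mergeRound {V : Type*} (G : SimpleGraph V) (C : List (Set V × Set V))
    (B : Set V × Set V) : List (Set V × Set V) :=
  C.map (mergeInto G B) ++ if ∃ B' ∈ C, Mergeable G B B' then [] else [B]

/-- The subroutine `MergeBiclique`: the entries are sorted by `ord` and then treated one after the
other, starting from the empty collection. -/
def MergeBiclique {V : Type*} (G : SimpleGraph V) (entries : List (Entry V))
    (C : List (Set V × Set V)) : Prop :=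
  ∃ sorted : List (Entry V), sorted.Perm entries ∧ sorted.Pairwise (fun a b => a.2 ≤ b.2) ∧
    C = (sorted.map Prod.fst).foldl (mergeRound G) []

/-- `RunOn G T C`: the algorithm, run on `G` with `T` as the clique tree of `Gᶜ` that it uses, can
return the collection `C`. It takes an optimal edge-ranking `φ` of `T` and a breadth-first
ordering `σ` of `T`, calls `FindBiclique` on `T`, and collects the results of `MergeBiclique` over
the levels `1, …, r`. -/
def RunOn {V : Type*} (G : SimpleGraph V) (T : SimpleGraph (MaxClique Gᶜ))
    (C : Set (Sym2 (Set V))) : Prop :=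
  IsCliqueTree Gᶜ T ∧
    ∃ (r : ℕ) (φ : Sym2 (MaxClique Gᶜ) → ℕ) (σ : MaxClique Gᶜ → ℕ)
      (d : ℕ → List (Entry V)) (M : ℕ → List (Set V × Set V)),
      r = edgeRankingNumber T ∧ IsEdgeRanking T r φ ∧ IsBFSOrdering T σ ∧
        FindBiclique T φ σ r Set.univ d ∧
        (∀ i ∈ Set.Icc 1 r, MergeBiclique G (d i) (M i)) ∧
        C = {B | ∃ i ∈ Set.Icc 1 r, ∃ L R : Set V, (L, R) ∈ M i ∧ B = s(L, R)}

/-- `Run G C`: the algorithm with input `G` can return `C`. -/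
def Run {V : Type*} (G : SimpleGraph V) (C : Set (Sym2 (Set V))) : Prop :=
  ∃ T : SimpleGraph (MaxClique Gᶜ), RunOn G T C

end BicliqueCover

/-!
A maximal clique of `Gᶜ` is independent in `G`, so it meets at most one side of each biclique, and
two distinct ones are told apart by the biclique that covers an edge of `G` between them. Hence
`k` bicliques that cover `G` force `mc Gᶜ ≤ 2 ^ k`, which is the lower bound.

For the upper bound it is enough that the algorithm produces at most one biclique per level. The
edge-ranking makes the cuts of one level come from disjoint subtrees. Listed in breadth-first order,
each of these subtrees is separated from all earlier ones by a single edge `ab` of the clique tree,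
the edge from its first vertex `a` to the parent `b` of `a`. As every vertex lies in at most two
maximal cliques, a vertex on the `a` side and a vertex on the `b` side can fail to be adjacent in
`G` only if they lie in `a` and `b` respectively. But `a` meets at most one side of the new
biclique, and `b` at most one side of the merged earlier ones, so one of the two orientations merges
them.

If `Gᶜ` is connected, the clique tree is unique: it is the intersection graph of the maximal
cliques.
-/

namespace BicliqueCover

section Trees

variable {W : Type*} {T : SimpleGraph W} {S S₁ S₂ : Set W} {a b w : W}

lemma exists_adj_mem_notMem (hT : T.Connected) {u v : W} (hu : u ∈ S) (hv : v ∉ S) :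
    ∃ x ∈ S, ∃ y ∉ S, T.Adj x y := by
  obtain ⟨p⟩ := hT.preconnected u v
  obtain ⟨d, -, hfst, hsnd⟩ := p.exists_boundary_dart S hu hv
  exact ⟨d.fst, hfst, d.snd, hsnd, d.adj⟩

/-- The part of the graph that stays connected to `a` when the edge `ab` is deleted. In a tree,
`side T a b` and `side T b a` are the two components that remain. -/
def side (T : SimpleGraph W) (a b : W) : Set W :=
  {w | (T.deleteEdges {s(a, b)}).Reachable a w}

lemma left_mem_side : a ∈ side T a b :=
  SimpleGraph.Reachable.refl a

lemma mem_side_of_adj {v : W} (hv : v ∈ side T a b) (hvw : T.Adj v w) (hne : s(v, w) ≠ s(a, b)) :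
    w ∈ side T a b :=
  SimpleGraph.Reachable.trans hv
    (SimpleGraph.Adj.reachable (SimpleGraph.deleteEdges_adj.2 ⟨hvw, hne⟩))

lemma mem_side_or_mem_side (hT : T.Connected) (a b w : W) :
    w ∈ side T a b ∨ w ∈ side T b a := by
  by_contra hw
  obtain ⟨x, hx, y, hy, hxy⟩ :=
    exists_adj_mem_notMem (S := side T a b ∪ side T b a) hT (Or.inl left_mem_side) hw
  have hne : s(x, y) ≠ s(a, b) := by
    intro he
    obtain ⟨-, rfl⟩ | ⟨-, rfl⟩ := Sym2.eq_iff.1 he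
    exacts [hy (Or.inr left_mem_side), hy (Or.inl left_mem_side)]
  refine hy (hx.imp (mem_side_of_adj · hxy hne) (mem_side_of_adj · hxy ?_))
  rwa [Sym2.eq_swap (a := b)]

lemma mem_edges_of_mem_side (hT : T.IsAcyclic) (hab : T.Adj a b) {w' : W} (hw : w ∈ side T a b)
    (hw' : w' ∈ side T b a) (p : T.Walk w w') : s(a, b) ∈ p.edges := by
  refine p.mem_edges_of_not_reachable_deleteEdges fun h => ?_
  rw [side, Sym2.eq_swap] at hw'
  exact SimpleGraph.isBridge_iff.1 (SimpleGraph.isAcyclic_iff_forall_adj_isBridge.1 hT hab)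
    ((hw.trans h).trans hw'.symm)

lemma disjoint_side (hT : T.IsAcyclic) (hab : T.Adj a b) :
    Disjoint (side T a b) (side T b a) :=
  Set.disjoint_left.2 fun w hw hw' => by
    simpa using mem_edges_of_mem_side hT hab hw hw' (SimpleGraph.Walk.nil (u := w))

lemma connected_induce_side : (T.induce (side T a b)).Connected := by
  have hside : side T a b = ((T.deleteEdges {s(a, b)}).connectedComponentMk a).supp :=
    Set.ext fun w => SimpleGraph.ConnectedComponent.eq.symm.trans eq_comm
  rw [hside]
  exact (SimpleGraph.ConnectedComponent.connected_toSimpleGraph _).mono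
    (SimpleGraph.comap_monotone _ (SimpleGraph.deleteEdges_le _))

lemma subset_side (hS : (T.induce S).Connected) (hwS : w ∈ S) (hw : w ∈ side T a b)
    (hab : a ∉ S ∨ b ∉ S) : S ⊆ side T a b := by
  by_contra hsub
  obtain ⟨v, hvS, hv⟩ := Set.not_subset.1 hsub
  obtain ⟨x, hx, y, hy, hxy⟩ := exists_adj_mem_notMem (S := Subtype.val ⁻¹' side T a b) hS
    (u := ⟨w, hwS⟩) (v := ⟨v, hvS⟩) hw hv
  refine hy (mem_side_of_adj hx hxy fun he => ?_)
  obtain ⟨rfl, rfl⟩ | ⟨rfl, rfl⟩ := Sym2.eq_iff.1 he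
  exacts [hab.elim (· x.2) (· y.2), hab.elim (· y.2) (· x.2)]

/-- Deleting the edge `ab` splits the connected vertex set `S` into the connected sets `S₁ ∋ a`
and `S₂ ∋ b`. -/
structure IsSplit (T : SimpleGraph W) (S S₁ S₂ : Set W) (a b : W) : Prop where
  union_eq : S₁ ∪ S₂ = S
  disjoint : Disjoint S₁ S₂
  connected_left : (T.induce S₁).Connected
  connected_right : (T.induce S₂).Connected
  left_mem : a ∈ S₁
  right_mem : b ∈ S₂
  adj : T.Adj a b

namespace IsSplit

lemma subset_left (h : IsSplit T S S₁ S₂ a b) : S₁ ⊆ S :=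
  h.union_eq ▸ Set.subset_union_left

lemma subset_right (h : IsSplit T S S₁ S₂ a b) : S₂ ⊆ S :=
  h.union_eq ▸ Set.subset_union_right

lemma connected (h : IsSplit T S S₁ S₂ a b) : (T.induce S).Connected :=
  h.union_eq ▸ SimpleGraph.connected_induce_union h.connected_left.preconnected
    h.connected_right.preconnected h.left_mem h.right_mem h.adj

lemma subset_side_left (h : IsSplit T S S₁ S₂ a b) : S₁ ⊆ side T a b :=
  subset_side h.connected_left h.left_mem left_mem_side
    (Or.inr (Set.disjoint_right.1 h.disjoint h.right_mem))

lemma subset_side_right (h : IsSplit T S S₁ S₂ a b) : S₂ ⊆ side T b a :=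
  subset_side h.connected_right h.right_mem left_mem_side
    (Or.inr (Set.disjoint_left.1 h.disjoint h.left_mem))

end IsSplit

lemma connected_induce_image_val {A : Set S} (hA : ((T.induce S).induce A).Connected) :
    (T.induce (Subtype.val '' A)).Connected := by
  let f : (T.induce S).induce A →g T.induce (Subtype.val '' A) :=
    ⟨fun w => ⟨w.1, Set.mem_image_of_mem _ w.2⟩, id⟩
  exact hA.map f (by rintro ⟨-, w, hw, rfl⟩; exact ⟨⟨w, hw⟩, rfl⟩)

lemma exists_isSplit (hT : T.IsAcyclic) (hS : (T.induce S).Connected) (ha : a ∈ S) (hb : b ∈ S)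
    (hab : T.Adj a b) : ∃ S₁ S₂, IsSplit T S S₁ S₂ a b := by
  have hadj : (T.induce S).Adj ⟨a, ha⟩ ⟨b, hb⟩ := hab
  refine ⟨Subtype.val '' side (T.induce S) ⟨a, ha⟩ ⟨b, hb⟩,
    Subtype.val '' side (T.induce S) ⟨b, hb⟩ ⟨a, ha⟩, ?_, ?_,
    connected_induce_image_val connected_induce_side,
    connected_induce_image_val connected_induce_side, ⟨_, left_mem_side, rfl⟩,
    ⟨_, left_mem_side, rfl⟩, hab⟩
  · have huniv : side (T.induce S) ⟨a, ha⟩ ⟨b, hb⟩ ∪ side (T.induce S) ⟨b, hb⟩ ⟨a, ha⟩ = Set.univ :=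
      Set.eq_univ_of_forall (mem_side_or_mem_side hS _ _)
    rw [← Set.image_union, huniv, Set.image_univ, Subtype.range_val]
  · exact (Set.disjoint_image_iff Subtype.val_injective).2 (disjoint_side (hT.induce S) hadj)

end Trees

section EdgeRankings

variable {W : Type*} {T : SimpleGraph W}

lemma IsEdgeRanking.eq_of_max {r : ℕ} {φ : Sym2 W → ℕ} (hφ : IsEdgeRanking T r φ) {S : Set W}
    (hS : (T.induce S).Connected) {a b c d : W} (ha : a ∈ S) (hab : T.Adj a b)
    (hmax : ∀ u ∈ S, ∀ v ∈ S, T.Adj u v → φ s(u, v) ≤ φ s(a, b))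
    (hc : c ∈ S) (hcd : T.Adj c d) (heq : φ s(a, b) = φ s(c, d)) : s(a, b) = s(c, d) := by
  by_contra hne
  obtain ⟨p, hp⟩ := hS.exists_isPath ⟨a, ha⟩ ⟨c, hc⟩
  let f : T.induce S →g T := ⟨Subtype.val, id⟩
  obtain ⟨e, he, hlt⟩ := hφ.2 _ hab _ hcd hne heq a (by simp) c (by simp) (p.map f)
    (SimpleGraph.Walk.IsPath.map (f := f) Subtype.val_injective hp)
  rw [SimpleGraph.Walk.edges_map, List.mem_map] at he
  obtain ⟨⟨x, y⟩, hxy, rfl⟩ := he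
  exact (hmax x x.2 y y.2 (p.adj_of_mem_edges hxy)).not_gt hlt

lemma exists_isEdgeRanking_edgeRankingNumber [Finite W] (T : SimpleGraph W) :
    ∃ φ : Sym2 W → ℕ, IsEdgeRanking T (edgeRankingNumber T) φ := by
  refine Nat.sInf_mem (s := {r : ℕ | ∃ φ : Sym2 W → ℕ, IsEdgeRanking T r φ}) ?_
  let f := Finite.equivFin (Sym2 W)
  refine ⟨Nat.card (Sym2 W), fun e => (f e : ℕ) + 1, fun e _ => ⟨Nat.le_add_left _ _, (f e).2⟩, ?_⟩
  intro e₁ _ e₂ _ hne heq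
  exact absurd (f.injective (Fin.ext (Nat.succ_injective heq))) hne

end EdgeRankings

section BreadthFirstSearch

variable {W : Type*} {T : SimpleGraph W} {ρ w : W} {σ : W → ℕ} {queue seen out : List W}

lemma BFS.exists_of_nodup [Finite W] (T : SimpleGraph W) :
    ∀ queue seen : List W, (seen ++ queue).Nodup → ∃ out, BFS T queue seen out
  | [], seen, _ => ⟨seen, .finish seen⟩
  | v :: queue, seen, hnd => by
    classical
    have := Fintype.ofFinite W
    obtain ⟨new, hnodup, hnew⟩ : ∃ new : List W, new.Nodup ∧
        ∀ w, w ∈ new ↔ T.Adj v w ∧ w ∉ v :: queue ∧ w ∉ seen :=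
      ⟨_, (Finset.univ.filter fun w => T.Adj v w ∧ w ∉ v :: queue ∧ w ∉ seen).nodup_toList,
        by simp⟩
    have hnd' : (seen ++ [v] ++ (queue ++ new)).Nodup := by
      have hdisj : List.Disjoint (seen ++ v :: queue) new := fun w hw hw' =>
        (List.mem_append.1 hw).elim ((hnew w).1 hw').2.2 ((hnew w).1 hw').2.1
      simpa using hnd.append hnodup hdisj
    have : seen.length < Nat.card W := by
      have := hnd.length_le_card
      simp only [List.length_append, List.length_cons, ← Nat.card_eq_fintype_card] at this
      lia
    obtain ⟨out, hout⟩ := BFS.exists_of_nodup T (queue ++ new) (seen ++ [v]) hnd'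
    exact ⟨out, .step v queue seen new out hnodup hnew hout⟩
  termination_by _ seen => Nat.card W - seen.length
  decreasing_by simp only [List.length_append, List.length_cons, List.length_nil]; lia

lemma BFS.isPrefix (h : BFS T queue seen out) : seen ++ queue <+: out := by
  induction h with
  | finish out => simp
  | step v queue seen new out _ _ _ ih =>
    refine List.IsPrefix.trans ?_ ih
    simp

lemma BFS.mem_of_adj (h : BFS T queue seen out)
    (hclosed : ∀ v ∈ seen, ∀ w, T.Adj v w → w ∈ seen ++ queue) :
    ∀ v ∈ out, ∀ w, T.Adj v w → w ∈ out := by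
  induction h with
  | finish out => simpa using hclosed
  | step v queue seen new _ _ hnew _ ih =>
    have hassoc : seen ++ [v] ++ (queue ++ new) = seen ++ v :: queue ++ new := by simp
    refine ih fun u hu w huw => hassoc ▸ List.mem_append.2 ?_
    obtain hu | hu := List.mem_append.1 hu
    · exact Or.inl (hclosed u hu w huw)
    · rw [List.mem_singleton.1 hu] at huw
      refine or_iff_not_imp_left.2 fun hw => ?_
      rw [List.mem_append, not_or] at hw
      exact (hnew w).2 ⟨huw, hw.2, hw.1⟩

open Classical in
/-- Every vertex of the list `l` other than `ρ` has a neighbour that comes earlier in `l`: the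
invariant of a search that starts at `ρ`. -/
def ParentsPrecede (T : SimpleGraph W) (ρ : W) (l : List W) : Prop :=
  ∀ w ∈ l, w ≠ ρ → ∃ w', T.Adj w w' ∧ l.idxOf w' < l.idxOf w

lemma ParentsPrecede.append {l new : List W} {v : W} (h : ParentsPrecede T ρ l) (hv : v ∈ l)
    (hnew : ∀ w ∈ new, T.Adj v w) : ParentsPrecede T ρ (l ++ new) := by
  classical
  intro w hw hwρ
  by_cases hwl : w ∈ l
  · obtain ⟨w', hadj, hlt⟩ := h w hwl hwρ
    have hw'l : w' ∈ l := List.idxOf_lt_length_iff.1 (hlt.trans (List.idxOf_lt_length_iff.2 hwl))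
    refine ⟨w', hadj, ?_⟩
    rwa [List.idxOf_append_of_mem hwl, List.idxOf_append_of_mem hw'l]
  · refine ⟨v, (hnew w ((List.mem_append.1 hw).resolve_left hwl)).symm, ?_⟩
    rw [List.idxOf_append_of_mem hv, List.idxOf_append_of_notMem hwl]
    exact (List.idxOf_lt_length_iff.2 hv).trans_le (Nat.le_add_right _ _)

lemma BFS.parentsPrecede (h : BFS T queue seen out) (hparent : ParentsPrecede T ρ (seen ++ queue)) :
    ParentsPrecede T ρ out := by
  induction h with
  | finish out => simpa using hparent
  | step v queue seen new _ _ hnew _ ih =>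
    refine ih ?_
    simpa using hparent.append (v := v) (by simp) fun w hw => ((hnew w).1 hw).1

/-- A numbering of the vertices that can arise from a graph search starting at `ρ`: every other
vertex has a neighbour with a smaller number. -/
structure IsSearchOrdering (T : SimpleGraph W) (ρ : W) (σ : W → ℕ) : Prop where
  injective : Function.Injective σ
  exists_adj_lt : ∀ w, w ≠ ρ → ∃ w', T.Adj w w' ∧ σ w' < σ w

lemma IsBFSOrdering.exists_isSearchOrdering (hT : T.Connected) (hσ : IsBFSOrdering T σ) :
    ∃ ρ, IsSearchOrdering T ρ σ := by
  classical
  obtain ⟨ρ, out, -, hbfs, hσ⟩ := hσ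
  have hall : ∀ w, w ∈ out := by
    by_contra! ⟨w, hw⟩
    obtain ⟨x, hx, y, hy, hxy⟩ := exists_adj_mem_notMem (S := {w | w ∈ out}) hT
      (hbfs.isPrefix.subset (by simp : ρ ∈ [] ++ [ρ])) hw
    exact hy (hbfs.mem_of_adj (by simp) x hx y hxy)
  have hparent : ParentsPrecede T ρ out :=
    hbfs.parentsPrecede fun w hw hwρ => absurd (by simpa using hw) hwρ
  refine ⟨ρ, fun w w' h => ?_, fun w hw => ?_⟩
  · rw [hσ, hσ] at h
    exact (List.idxOf_inj (hall w)).1 (Nat.succ_injective h)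
  · obtain ⟨w', hadj, hlt⟩ := hparent w (hall w) hw
    exact ⟨w', hadj, by rw [hσ, hσ]; lia⟩

lemma exists_subsingleton_neighborSet [Finite W] (hT : T.IsTree) :
    ∃ ρ, (T.neighborSet ρ).Subsingleton := by
  classical
  have := Fintype.ofFinite W
  rcases subsingleton_or_nontrivial W with h | h
  · obtain ⟨ρ⟩ := hT.connected.nonempty
    exact ⟨ρ, Set.subsingleton_of_subsingleton⟩
  · obtain ⟨ρ, hρ⟩ := hT.exists_vert_degree_one_of_nontrivial
    obtain ⟨w, -, hw⟩ := SimpleGraph.degree_eq_one_iff_existsUnique_adj.1 hρ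
    exact ⟨ρ, fun x hx y hy => (hw x hx).trans (hw y hy).symm⟩

lemma exists_isBFSOrdering [Finite W] (hT : T.IsTree) : ∃ σ, IsBFSOrdering T σ := by
  classical
  obtain ⟨ρ, hρ⟩ := exists_subsingleton_neighborSet hT
  obtain ⟨out, hout⟩ := BFS.exists_of_nodup T [ρ] [] (by simp)
  exact ⟨fun w => out.idxOf w + 1, ρ, out, hρ, hout, fun _ => rfl⟩

namespace IsSearchOrdering

lemma induction (h : IsSearchOrdering T ρ σ) {P : W → Prop} (root : P ρ)
    (step : ∀ w w', T.Adj w w' → σ w' < σ w → P w' → P w) (w : W) : P w := by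
  induction hn : σ w using Nat.strong_induction_on generalizing w with
  | _ n ih =>
    by_cases hw : w = ρ
    · rwa [hw]
    · obtain ⟨w', hadj, hlt⟩ := h.exists_adj_lt w hw
      exact step w w' hadj hlt (ih _ (hn ▸ hlt) w' rfl)

lemma root_le (h : IsSearchOrdering T ρ σ) (w : W) : σ ρ ≤ σ w :=
  h.induction (P := fun w => σ ρ ≤ σ w) le_rfl (fun _ _ _ hlt hle => hle.trans hlt.le) w

lemma reachable_root (h : IsSearchOrdering T ρ σ) {a b : W} (hba : σ b < σ a) :
    σ w < σ a → (T.deleteEdges {s(b, a)}).Reachable w ρ := by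
  refine h.induction (P := fun w => σ w < σ a → (T.deleteEdges {s(b, a)}).Reachable w ρ)
    (fun _ => .rfl) (fun w w' hadj hlt ih hwa => ?_) w
  have hne : s(w, w') ≠ s(b, a) := by
    rintro he
    obtain ⟨-, rfl⟩ | ⟨rfl, -⟩ := Sym2.eq_iff.1 he
    exacts [lt_asymm hlt hwa, lt_irrefl _ hwa]
  exact (SimpleGraph.deleteEdges_adj.2 ⟨hadj, hne⟩).reachable.trans (ih (hlt.trans hwa))

lemma exists_adj_forall_lt_mem_side (h : IsSearchOrdering T ρ σ) {a w₀ : W} (hw₀ : σ w₀ < σ a) :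
    ∃ b, T.Adj a b ∧ σ b < σ a ∧ ∀ w, σ w < σ a → w ∈ side T b a := by
  have haρ : a ≠ ρ := by
    rintro rfl
    exact (h.root_le w₀).not_gt hw₀
  obtain ⟨b, hab, hba⟩ := h.exists_adj_lt a haρ
  exact ⟨b, hab, hba, fun w hw => (h.reachable_root hba hba).trans (h.reachable_root hba hw).symm⟩

end IsSearchOrdering

end BreadthFirstSearch

section Cliques

variable {V : Type*} {G H : SimpleGraph V} {K : Set V} {x y : V}

lemma exists_maxClique_superset {s : Set V} (hs : H.IsClique s) : ∃ K : MaxClique H, s ⊆ K.1 := by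
  obtain ⟨K, hsK, hK⟩ := zorn_subset_nonempty {s | H.IsClique s}
    (fun c hc hchain _ => ⟨⋃₀ c, (SimpleGraph.isClique_sUnion hchain.directedOn).2 hc,
      fun s => Set.subset_sUnion_of_mem⟩) s hs
  exact ⟨⟨K, hK⟩, hsK⟩

lemma exists_mem_maxClique (h : H.Adj x y) : ∃ K : MaxClique H, x ∈ K.1 ∧ y ∈ K.1 := by
  obtain ⟨K, hK⟩ := exists_maxClique_superset (SimpleGraph.isClique_pair.2 fun _ => h)
  exact ⟨K, hK (by simp), hK (by simp)⟩

lemma MaxClique.exists_mem_notMem {K K' : MaxClique H} (h : K ≠ K') : ∃ x ∈ K.1, x ∉ K'.1 := by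
  by_contra! hsub
  exact h (Subtype.ext (K.2.eq_of_subset K'.2.prop hsub))

lemma not_adj_of_mem_clique (hK : Gᶜ.IsClique K) (hx : x ∈ K) (hy : y ∈ K) : ¬ G.Adj x y :=
  fun h => (hK hx hy h.ne).2 h

lemma MaxClique.exists_adj {I J : MaxClique Gᶜ} (h : I ≠ J) : ∃ u ∈ I.1, ∃ v ∈ J.1, G.Adj u v := by
  obtain ⟨u, huI, huJ⟩ := MaxClique.exists_mem_notMem h
  by_contra! hno
  exact huJ (J.2.mem_of_prop_insert
    (SimpleGraph.IsClique.insert J.2.prop fun v hv hne => ⟨hne, hno u huI v hv⟩))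

lemma adj_iff_forall_maxClique : G.Adj x y ↔ ∀ K : MaxClique Gᶜ, x ∈ K.1 → y ∉ K.1 := by
  refine ⟨fun h K hx hy => not_adj_of_mem_clique K.2.prop hx hy h, fun h => ?_⟩
  by_contra hadj
  obtain ⟨K, hK⟩ := exists_maxClique_superset (H := Gᶜ)
    (SimpleGraph.isClique_pair.2 fun hne => ⟨hne, hadj⟩)
  exact h K (hK (by simp)) (hK (by simp))

end Cliques

section Bicliques

variable {V : Type*} {G : SimpleGraph V} {L R L' R' K : Set V}

lemma isBiclique_of_adj (hL : L.Nonempty) (hR : R.Nonempty) (h : ∀ u ∈ L, ∀ v ∈ R, G.Adj u v) :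
    IsBiclique G L R :=
  ⟨hL, hR, Set.disjoint_left.2 fun x hx hx' => (h x hx x hx').ne rfl, h⟩

lemma IsBiclique.symm (h : IsBiclique G L R) : IsBiclique G R L :=
  ⟨h.2.1, h.1, h.2.2.1.symm, fun u hu v hv => (h.2.2.2 v hv u hu).symm⟩

lemma IsBiclique.union (h : IsBiclique G L R) (h' : IsBiclique G L' R')
    (hLR' : ∀ u ∈ L, ∀ v ∈ R', G.Adj u v) (hL'R : ∀ u ∈ L', ∀ v ∈ R, G.Adj u v) :
    IsBiclique G (L ∪ L') (R ∪ R') := by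
  refine isBiclique_of_adj (h.1.mono Set.subset_union_left) (h.2.1.mono Set.subset_union_left) ?_
  rintro u (hu | hu) v (hv | hv)
  exacts [h.2.2.2 u hu v hv, hLR' u hu v hv, hL'R u hu v hv, h'.2.2.2 u hu v hv]

lemma IsBiclique.disjoint_left_or_right (h : IsBiclique G L R) (hK : Gᶜ.IsClique K) :
    Disjoint K L ∨ Disjoint K R := by
  by_contra! hmeet
  obtain ⟨u, huK, hu⟩ := Set.not_disjoint_iff.1 hmeet.1
  obtain ⟨v, hvK, hv⟩ := Set.not_disjoint_iff.1 hmeet.2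
  exact not_adj_of_mem_clique hK huK hvK (h.2.2.2 u hu v hv)

end Bicliques

namespace IsBicliqueCover

variable {V : Type*} {G : SimpleGraph V} {C : Set (Sym2 (Set V))}

lemma exists_meet_sides (hC : IsBicliqueCover G C) {I J : MaxClique Gᶜ} (hIJ : I ≠ J) :
    ∃ L R, s(L, R) ∈ C ∧ ¬ Disjoint I.1 L ∧ ¬ Disjoint J.1 R := by
  obtain ⟨u, hu, v, hv, huv⟩ := MaxClique.exists_adj hIJ
  obtain ⟨L, R, hLR, huL, hvR⟩ := hC.2 u v huv
  exact ⟨L, R, hLR, Set.not_disjoint_iff.2 ⟨u, hu, huL⟩, Set.not_disjoint_iff.2 ⟨v, hv, hvR⟩⟩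

lemma mc_le_two_pow_ncard (hC : IsBicliqueCover G C) (hfin : C.Finite) :
    mc Gᶜ ≤ 2 ^ C.ncard := by
  let meets (K : MaxClique Gᶜ) : 𝒫 C :=
    ⟨{B ∈ C | ¬ Disjoint K.1 (Quot.out B).1}, Set.sep_subset _ _⟩
  have hmeets : Function.Injective meets := by
    intro I J hIJ
    by_contra hne
    obtain ⟨L, R, hLR, hIL, hJR⟩ := hC.exists_meet_sides hne
    have hiff : Disjoint I.1 (Quot.out s(L, R)).1 ↔ Disjoint J.1 (Quot.out s(L, R)).1 := by
      simpa [meets, hLR, not_iff_not] using congrArg (s(L, R) ∈ ·.1) hIJ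
    have hI := (hC.1 L R hLR).disjoint_left_or_right I.2.prop
    have hJ := (hC.1 L R hLR).disjoint_left_or_right J.2.prop
    have hout : s((Quot.out s(L, R)).1, (Quot.out s(L, R)).2) = s(L, R) := Quot.out_eq s(L, R)
    obtain ⟨h, -⟩ | ⟨h, -⟩ := Sym2.eq_iff.1 hout <;> rw [h] at hiff <;> tauto
  have : Finite (𝒫 C) := hfin.powerset
  calc mc Gᶜ ≤ Nat.card (𝒫 C) := Nat.card_le_card_of_injective meets hmeets
    _ = 2 ^ C.ncard := by rw [Nat.card_coe_set_eq, Set.ncard_powerset C hfin]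

lemma ceil_logb_mc_le_ncard (hC : IsBicliqueCover G C) (hfin : C.Finite) :
    ⌈Real.logb 2 (mc Gᶜ)⌉₊ ≤ C.ncard := by
  have hclog : ⌈Real.logb 2 (mc Gᶜ)⌉₊ = Nat.clog 2 (mc Gᶜ) :=
    mod_cast Real.natCeil_logb_natCast 2 (mc Gᶜ)
  rw [hclog]
  exact Nat.clog_le_of_le_pow (hC.mc_le_two_pow_ncard hfin)

lemma isMinimumBicliqueCover (hC : IsBicliqueCover G C)
    (hle : C.encard ≤ ⌈Real.logb 2 (mc Gᶜ)⌉₊) : IsMinimumBicliqueCover G C := by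
  obtain ⟨hfin, hle⟩ := Set.encard_le_coe_iff_finite_ncard_le.1 hle
  refine ⟨hfin, hC, le_antisymm (le_csInf ⟨_, C, hfin, hC, rfl⟩ ?_)
    (Nat.sInf_le ⟨C, hfin, hC, rfl⟩)⟩
  rintro k ⟨C', hfin', hC', rfl⟩
  exact hle.trans (hC'.ceil_logb_mc_le_ncard hfin')

lemma bc_eq (hC : IsBicliqueCover G C) (hle : C.encard ≤ ⌈Real.logb 2 (mc Gᶜ)⌉₊) :
    bc G = ⌈Real.logb 2 (mc Gᶜ)⌉₊ := by
  obtain ⟨hfin, -, hcard⟩ := hC.isMinimumBicliqueCover hle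
  exact hcard ▸ (Set.encard_le_coe_iff_finite_ncard_le.1 hle).2.antisymm
    (hC.ceil_logb_mc_le_ncard hfin)

end IsBicliqueCover

section CliqueTrees

variable {V : Type*} {G H : SimpleGraph V} {x y : V}

lemma mem_cliqueUnion {S : Set (MaxClique H)} : x ∈ cliqueUnion S ↔ ∃ K ∈ S, x ∈ K.1 := by
  simp only [cliqueUnion, Set.mem_iUnion, exists_prop]

lemma cliqueUnion_mono {S S' : Set (MaxClique H)} (h : S ⊆ S') : cliqueUnion S ⊆ cliqueUnion S' :=
  Set.biUnion_subset_biUnion_left h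

lemma cliqueUnion_union (S S' : Set (MaxClique H)) :
    cliqueUnion (S ∪ S') = cliqueUnion S ∪ cliqueUnion S' :=
  Set.biUnion_union S S' _

/-- Every vertex lies in at most two maximal cliques: of any three that contain it, two are
equal. -/
def AtMostTwoCliques (H : SimpleGraph V) : Prop :=
  ∀ (v : V) (K₁ K₂ K₃ : MaxClique H), v ∈ K₁.1 → v ∈ K₂.1 → v ∈ K₃.1 →
    K₁ = K₂ ∨ K₁ = K₃ ∨ K₂ = K₃

lemma atMostTwoCliques_compl [Finite V]
    (htwo : ∀ v : V, {I : Set V | Maximal G.IsIndepSet I ∧ v ∈ I}.ncard ≤ 2) :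
    AtMostTwoCliques Gᶜ := by
  intro v K₁ K₂ K₃ h₁ h₂ h₃
  by_contra! ⟨h₁₂, h₁₃, h₂₃⟩
  have hindep (K : MaxClique Gᶜ) : Maximal G.IsIndepSet K.1 :=
    ⟨G.isClique_compl.1 K.2.prop, fun I hI => K.2.le_of_ge (G.isClique_compl.2 hI)⟩
  refine (htwo v).not_gt ((Set.two_lt_ncard (Set.toFinite _)).2 ?_)
  exact ⟨K₁.1, ⟨hindep K₁, h₁⟩, K₂.1, ⟨hindep K₂, h₂⟩, K₃.1, ⟨hindep K₃, h₃⟩,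
    Subtype.coe_injective.ne h₁₂, Subtype.coe_injective.ne h₁₃, Subtype.coe_injective.ne h₂₃⟩

namespace IsCliqueTree

variable {T T' : SimpleGraph (MaxClique H)} {a b K K' : MaxClique H}

lemma cliqueUnion_side_inter_subset (hT : IsCliqueTree H T) (hab : T.Adj a b) :
    cliqueUnion (side T a b) ∩ cliqueUnion (side T b a) ⊆ a.1 ∩ b.1 := by
  rintro x ⟨hx, hx'⟩
  obtain ⟨K, hK, hxK⟩ := mem_cliqueUnion.1 hx
  obtain ⟨K', hK', hxK'⟩ := mem_cliqueUnion.1 hx'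
  obtain ⟨p, hp⟩ := hT.1.connected.exists_isPath K K'
  have he := mem_edges_of_mem_side hT.1.isAcyclic hab hK hK' p
  exact ⟨hT.2 K K' p hp a (p.fst_mem_support_of_mem_edges he) ⟨hxK, hxK'⟩,
    hT.2 K K' p hp b (p.snd_mem_support_of_mem_edges he) ⟨hxK, hxK'⟩⟩

lemma eq_and_mem_of_mem_side (hT : IsCliqueTree H T) (h2 : AtMostTwoCliques H) (hab : T.Adj a b)
    (hK : K ∈ side T a b) (hxK : x ∈ K.1) (hx : x ∈ cliqueUnion (side T b a)) :
    K = a ∧ x ∈ b.1 := by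
  obtain ⟨hxa, hxb⟩ :=
    hT.cliqueUnion_side_inter_subset hab ⟨mem_cliqueUnion.2 ⟨K, hK, hxK⟩, hx⟩
  have hKb : K ≠ b := by
    rintro rfl
    exact Set.disjoint_left.1 (disjoint_side hT.1.isAcyclic hab) hK left_mem_side
  have := h2 x K a b hxK hxa hxb
  exact ⟨(this.resolve_right fun h => h.elim hKb hab.ne), hxb⟩

lemma mem_ends_of_mem_of_mem (hT : IsCliqueTree H T) (h2 : AtMostTwoCliques H) (hab : T.Adj a b)
    (hx : x ∈ cliqueUnion (side T a b)) (hy : y ∈ cliqueUnion (side T b a)) (hxK : x ∈ K.1)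
    (hyK : y ∈ K.1) : x ∈ a.1 ∧ y ∈ b.1 := by
  rcases mem_side_or_mem_side hT.1.connected a b K with hK | hK
  · obtain ⟨rfl, hyb⟩ := hT.eq_and_mem_of_mem_side h2 hab hK hyK hy
    exact ⟨hxK, hyb⟩
  · obtain ⟨rfl, hxa⟩ := hT.eq_and_mem_of_mem_side h2 hab.symm hK hxK hx
    exact ⟨hxa, hyK⟩

lemma inter_nonempty_of_adj (hT : IsCliqueTree H T) (hH : H.Connected) (hab : T.Adj a b) :
    (a.1 ∩ b.1).Nonempty := by
  suffices (cliqueUnion (side T a b) ∩ cliqueUnion (side T b a)).Nonempty from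
    this.mono (hT.cliqueUnion_side_inter_subset hab)
  obtain ⟨x, hx, -⟩ := MaxClique.exists_mem_notMem hab.ne
  obtain ⟨y, hy, -⟩ := MaxClique.exists_mem_notMem hab.ne'
  have hx' := mem_cliqueUnion.2 ⟨a, left_mem_side (T := T) (b := b), hx⟩
  have hy' := mem_cliqueUnion.2 ⟨b, left_mem_side (T := T) (b := a), hy⟩
  by_cases hya : y ∈ cliqueUnion (side T a b)
  · exact ⟨y, hya, hy'⟩
  obtain ⟨u, hu, v, hv, huv⟩ := exists_adj_mem_notMem hH hx' hya
  obtain ⟨K, huK, hvK⟩ := exists_mem_maxClique huv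
  have hK : K ∈ side T b a := (mem_side_or_mem_side hT.1.connected a b K).resolve_left
    fun h => hv (mem_cliqueUnion.2 ⟨K, h, hvK⟩)
  exact ⟨u, hu, mem_cliqueUnion.2 ⟨K, hK, huK⟩⟩

lemma adj_of_inter_nonempty (hT : IsCliqueTree H T) (h2 : AtMostTwoCliques H) (hne : K ≠ K')
    (hinter : (K.1 ∩ K'.1).Nonempty) : T.Adj K K' := by
  obtain ⟨x, hx⟩ := hinter
  obtain ⟨p, hp⟩ := hT.1.connected.exists_isPath K K'
  have hxp := hT.2 K K' p hp
  cases p with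
  | nil => exact absurd rfl hne
  | @cons _ A _ hKA q =>
    have hxA : x ∈ A.1 := hxp A (by simp) hx
    obtain h | h | rfl := h2 x K A K' hx.1 hxA hx.2
    exacts [absurd h hKA.ne, absurd h hne, hKA]

lemma eq (hT : IsCliqueTree H T) (hT' : IsCliqueTree H T') (h2 : AtMostTwoCliques H)
    (hH : H.Connected) : T = T' := by
  ext K K'
  exact ⟨fun h => hT'.adj_of_inter_nonempty h2 h.ne (hT.inter_nonempty_of_adj hH h),
    fun h => hT.adj_of_inter_nonempty h2 h.ne (hT'.inter_nonempty_of_adj hH h)⟩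

end IsCliqueTree

end CliqueTrees

section Cuts

variable {V : Type*} {H : SimpleGraph V} {T : SimpleGraph (MaxClique H)}
  {φ : Sym2 (MaxClique H) → ℕ} {σ : MaxClique H → ℕ} {r i : ℕ} {S S₁ S₂ : Set (MaxClique H)}
  {K₁ K₂ : MaxClique H} {d : ℕ → List (Entry V)} {E E' : Entry V} {u v : V}
  {B B' B'' : Set V × Set V}

/-- The sides of `B` are contained in the sides of `B'`, in one of the two orders: inclusion of
bicliques regarded as unordered pairs. -/
def IsSubpair (B B' : Set V × Set V) : Prop :=
  B ≤ B' ∨ B.swap ≤ B'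

lemma IsSubpair.trans_le (h : IsSubpair B B') (h' : B' ≤ B'') : IsSubpair B B'' :=
  h.imp h'.trans' h'.trans'

lemma IsSubpair.trans (h : IsSubpair B B') (h' : IsSubpair B' B'') : IsSubpair B B'' := by
  rcases h' with h' | h'
  · exact h.trans_le h'
  · exact (h.imp (Prod.swap_le_swap.2 · |>.trans h') (Prod.swap_le_swap.2 · |>.trans h')).symm

/-- The pair `{L, R}` that the algorithm stores when the edge `K₁K₂` splits a subtree into `S₁` and
`S₂`. -/
def cutPair (S₁ S₂ : Set (MaxClique H)) (K₁ K₂ : MaxClique H) : Set V × Set V :=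
  (cliqueUnion S₁ \ (K₁.1 ∩ K₂.1), cliqueUnion S₂ \ (K₁.1 ∩ K₂.1))

/-- `E` is an entry that the algorithm can store when it cuts the subtree with vertex set `S`. -/
def IsCutEntry (T : SimpleGraph (MaxClique H)) (σ : MaxClique H → ℕ) (S : Set (MaxClique H))
    (E : Entry V) : Prop :=
  ∃ S₁ S₂ K₁ K₂, IsSplit T S S₁ S₂ K₁ K₂ ∧ E = (cutPair S₁ S₂ K₁ K₂, sInf (σ '' S))

namespace IsCutEntry

lemma subset (h : IsCutEntry T σ S E) : E.1.1 ∪ E.1.2 ⊆ cliqueUnion S := by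
  obtain ⟨S₁, S₂, K₁, K₂, h, rfl⟩ := h
  exact Set.union_subset (Set.sdiff_subset.trans (cliqueUnion_mono h.subset_left))
    (Set.sdiff_subset.trans (cliqueUnion_mono h.subset_right))

lemma connected (h : IsCutEntry T σ S E) : (T.induce S).Connected := by
  obtain ⟨S₁, S₂, K₁, K₂, h, -⟩ := h
  exact h.connected

lemma exists_mem_eq (h : IsCutEntry T σ S E) : ∃ K ∈ S, σ K = E.2 := by
  obtain ⟨⟨K, hK⟩⟩ := h.connected.nonempty
  obtain ⟨S₁, S₂, K₁, K₂, -, rfl⟩ := h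
  exact Nat.sInf_mem (Set.Nonempty.image σ ⟨K, hK⟩)

lemma le_of_mem (h : IsCutEntry T σ S E) {K : MaxClique H} (hK : K ∈ S) : E.2 ≤ σ K := by
  obtain ⟨S₁, S₂, K₁, K₂, -, rfl⟩ := h
  exact Nat.sInf_le (Set.mem_image_of_mem σ hK)

lemma subset_cliqueUnion_side (h : IsCutEntry T σ S E) {a b w : MaxClique H} (hwS : w ∈ S)
    (hw : w ∈ side T a b) (hab : a ∉ S ∨ b ∉ S) : E.1.1 ∪ E.1.2 ⊆ cliqueUnion (side T a b) :=
  h.subset.trans (cliqueUnion_mono (subset_side h.connected hwS hw hab))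

lemma isBiclique {G : SimpleGraph V} {T : SimpleGraph (MaxClique Gᶜ)} {σ : MaxClique Gᶜ → ℕ}
    {S : Set (MaxClique Gᶜ)} (hT : IsCliqueTree Gᶜ T) (h : IsCutEntry T σ S E) :
    IsBiclique G E.1.1 E.1.2 := by
  obtain ⟨S₁, S₂, K₁, K₂, h, rfl⟩ := h
  obtain ⟨x, hx₁, hx₂⟩ := MaxClique.exists_mem_notMem h.adj.ne
  obtain ⟨y, hy₂, hy₁⟩ := MaxClique.exists_mem_notMem h.adj.ne'
  refine isBiclique_of_adj ⟨x, mem_cliqueUnion.2 ⟨K₁, h.left_mem, hx₁⟩, fun hx => hx₂ hx.2⟩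
    ⟨y, mem_cliqueUnion.2 ⟨K₂, h.right_mem, hy₂⟩, fun hy => hy₁ hy.1⟩ ?_
  rintro u ⟨hu, hu'⟩ v ⟨hv, hv'⟩
  refine adj_iff_forall_maxClique.2 fun K huK hvK => ?_
  rcases mem_side_or_mem_side hT.1.connected K₁ K₂ K with hK | hK
  · exact hv' (hT.cliqueUnion_side_inter_subset h.adj
      ⟨mem_cliqueUnion.2 ⟨K, hK, hvK⟩, cliqueUnion_mono h.subset_side_right hv⟩)
  · exact hu' (hT.cliqueUnion_side_inter_subset h.adj
      ⟨cliqueUnion_mono h.subset_side_left hu, mem_cliqueUnion.2 ⟨K, hK, huK⟩⟩)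

end IsCutEntry

/-- The entries `E` and `E'` come from cuts of disjoint subtrees. -/
def DisjointCuts (T : SimpleGraph (MaxClique H)) (σ : MaxClique H → ℕ) (E E' : Entry V) : Prop :=
  ∃ S S', Disjoint S S' ∧ IsCutEntry T σ S E ∧ IsCutEntry T σ S' E'

lemma DisjointCuts.symm (h : DisjointCuts T σ E E') : DisjointCuts T σ E' E := by
  obtain ⟨S, S', hdisj, hE, hE'⟩ := h
  exact ⟨S', S, hdisj.symm, hE', hE⟩

lemma IsSplit.isSubpair_cutPair (h : IsSplit T S S₁ S₂ K₁ K₂) (hu : u ∈ cliqueUnion S)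
    (hv : v ∈ cliqueUnion S) (h₁ : ¬ (u ∈ cliqueUnion S₁ ∧ v ∈ cliqueUnion S₁))
    (h₂ : ¬ (u ∈ cliqueUnion S₂ ∧ v ∈ cliqueUnion S₂)) :
    IsSubpair ({u}, {v}) (cutPair S₁ S₂ K₁ K₂) := by
  have hK₁ {x : V} (hx : x ∈ K₁.1 ∩ K₂.1) : x ∈ cliqueUnion S₁ :=
    mem_cliqueUnion.2 ⟨K₁, h.left_mem, hx.1⟩
  have hK₂ {x : V} (hx : x ∈ K₁.1 ∩ K₂.1) : x ∈ cliqueUnion S₂ :=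
    mem_cliqueUnion.2 ⟨K₂, h.right_mem, hx.2⟩
  rw [← h.union_eq, cliqueUnion_union] at hu hv
  simp only [IsSubpair, cutPair, Prod.swap_prod_mk, Prod.mk_le_mk,
    Set.singleton_subset_iff]
  rcases hu with hu | hu <;> rcases hv with hv | hv
  · exact absurd ⟨hu, hv⟩ h₁
  · exact Or.inl ⟨⟨hu, fun hx => h₂ ⟨hK₂ hx, hv⟩⟩, hv, fun hx => h₁ ⟨hu, hK₁ hx⟩⟩
  · exact Or.inr ⟨⟨hv, fun hx => h₂ ⟨hu, hK₂ hx⟩⟩, hu, fun hx => h₁ ⟨hK₁ hx, hv⟩⟩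
  · exact absurd ⟨hu, hv⟩ h₂

namespace FindBiclique

lemma exists_adj_of_mem (h : FindBiclique T φ σ r S d) (hE : E ∈ d i) :
    ∃ K ∈ S, ∃ K' ∈ S, T.Adj K K' ∧ i = r + 1 - φ s(K, K') := by
  induction h with
  | small => simp at hE
  | cut S S₁ S₂ K₁ K₂ d₁ d₂ _ hunion _ _ _ hK₁ hK₂ hadj _ _ _ ih₁ ih₂ =>
    subst hunion
    simp only [List.mem_append, List.mem_ite_nil_right] at hE
    obtain (⟨rfl, -⟩ | hE) | hE := hE
    · exact ⟨K₁, Or.inl hK₁, K₂, Or.inr hK₂, hadj, rfl⟩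
    · obtain ⟨K, hK, K', hK', h⟩ := ih₁ hE
      exact ⟨K, Or.inl hK, K', Or.inl hK', h⟩
    · obtain ⟨K, hK, K', hK', h⟩ := ih₂ hE
      exact ⟨K, Or.inr hK, K', Or.inr hK', h⟩

lemma exists_isCutEntry (h : FindBiclique T φ σ r S d) (hE : E ∈ d i) :
    ∃ S' ⊆ S, IsCutEntry T σ S' E := by
  induction h with
  | small => simp at hE
  | cut S S₁ S₂ K₁ K₂ d₁ d₂ _ hunion hdisj hconn₁ hconn₂ hK₁ hK₂ hadj _ _ _ ih₁ ih₂ =>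
    have hsplit : IsSplit T S S₁ S₂ K₁ K₂ := ⟨hunion, hdisj, hconn₁, hconn₂, hK₁, hK₂, hadj⟩
    simp only [List.mem_append, List.mem_ite_nil_right, List.mem_singleton] at hE
    obtain (⟨-, rfl⟩ | hE) | hE := hE
    · exact ⟨S, subset_rfl, S₁, S₂, K₁, K₂, hsplit, rfl⟩
    · exact (ih₁ hE).imp fun _ h => ⟨h.1.trans hsplit.subset_left, h.2⟩
    · exact (ih₂ hE).imp fun _ h => ⟨h.1.trans hsplit.subset_right, h.2⟩

lemma eq_nil_of_max {S' : Set (MaxClique H)} (h : FindBiclique T φ σ r S' d)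
    (hφ : IsEdgeRanking T r φ) (hS : (T.induce S).Connected) (hS' : S' ⊆ S) (hK₁ : K₁ ∈ S)
    (hadj : T.Adj K₁ K₂)
    (hmax : ∀ K ∈ S, ∀ K' ∈ S, T.Adj K K' → φ s(K, K') ≤ φ s(K₁, K₂))
    (hnot : K₁ ∉ S' ∨ K₂ ∉ S') : d (r + 1 - φ s(K₁, K₂)) = [] := by
  refine List.eq_nil_iff_forall_not_mem.2 fun E hE => ?_
  obtain ⟨K, hK, K', hK', hKK', hlevel⟩ := h.exists_adj_of_mem hE
  have hrange₁ := hφ.1 s(K₁, K₂) hadj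
  have hrange := hφ.1 s(K, K') hKK'
  have heq : s(K₁, K₂) = s(K, K') := hφ.eq_of_max hS hK₁ hadj hmax (hS' hK) hKK' (by lia)
  obtain ⟨rfl, rfl⟩ | ⟨rfl, rfl⟩ := Sym2.eq_iff.1 heq
  exacts [hnot.elim (· hK) (· hK'), hnot.elim (· hK') (· hK)]

lemma pairwise_disjointCuts (h : FindBiclique T φ σ r S d) (hφ : IsEdgeRanking T r φ) (i : ℕ) :
    (d i).Pairwise (DisjointCuts T σ) := by
  induction h with
  | small => exact List.Pairwise.nil
  | cut S S₁ S₂ K₁ K₂ d₁ d₂ _ hunion hdisj hconn₁ hconn₂ hK₁ hK₂ hadj hmax h₁ h₂ ih₁ ih₂ =>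
    have hsplit : IsSplit T S S₁ S₂ K₁ K₂ := ⟨hunion, hdisj, hconn₁, hconn₂, hK₁, hK₂, hadj⟩
    by_cases hi : i = r + 1 - φ s(K₁, K₂)
    · subst hi
      have hnil₁ : d₁ (r + 1 - φ s(K₁, K₂)) = [] := h₁.eq_nil_of_max hφ hsplit.connected
        hsplit.subset_left (hsplit.subset_left hK₁) hadj hmax
        (Or.inr (Set.disjoint_right.1 hdisj hK₂))
      have hnil₂ : d₂ (r + 1 - φ s(K₁, K₂)) = [] := h₂.eq_nil_of_max hφ hsplit.connected
        hsplit.subset_right (hsplit.subset_left hK₁) hadj hmax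
        (Or.inl (Set.disjoint_left.1 hdisj hK₁))
      simp [hnil₁, hnil₂]
    · simp only [if_neg hi, List.nil_append]
      refine List.pairwise_append.2 ⟨ih₁, ih₂, fun E hE E' hE' => ?_⟩
      obtain ⟨A, hA, hcut⟩ := h₁.exists_isCutEntry hE
      obtain ⟨A', hA', hcut'⟩ := h₂.exists_isCutEntry hE'
      exact ⟨A, A', hdisj.mono hA hA', hcut, hcut'⟩

lemma exists_isSubpair (h : FindBiclique T φ σ r S d) (hφ : IsEdgeRanking T r φ)
    (huv : ∀ K : MaxClique H, u ∈ K.1 → v ∉ K.1) (hu : u ∈ cliqueUnion S)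
    (hv : v ∈ cliqueUnion S) : ∃ i ∈ Set.Icc 1 r, ∃ E ∈ d i, IsSubpair ({u}, {v}) E.1 := by
  induction h with
  | small S hS =>
    obtain ⟨K, hK, huK⟩ := mem_cliqueUnion.1 hu
    obtain ⟨K', hK', hvK'⟩ := mem_cliqueUnion.1 hv
    exact absurd (hS hK' hK ▸ hvK') (huv K huK)
  | cut S S₁ S₂ K₁ K₂ d₁ d₂ _ hunion hdisj hconn₁ hconn₂ hK₁ hK₂ hadj _ _ _ ih₁ ih₂ =>
    by_cases h₁ : u ∈ cliqueUnion S₁ ∧ v ∈ cliqueUnion S₁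
    · obtain ⟨i, hi, E, hE, hsub⟩ := ih₁ h₁.1 h₁.2
      exact ⟨i, hi, E, List.mem_append_left _ (List.mem_append_right _ hE), hsub⟩
    by_cases h₂ : u ∈ cliqueUnion S₂ ∧ v ∈ cliqueUnion S₂
    · obtain ⟨i, hi, E, hE, hsub⟩ := ih₂ h₂.1 h₂.2
      exact ⟨i, hi, E, List.mem_append_right _ hE, hsub⟩
    have hsplit : IsSplit T S S₁ S₂ K₁ K₂ := ⟨hunion, hdisj, hconn₁, hconn₂, hK₁, hK₂, hadj⟩
    have hrange := hφ.1 s(K₁, K₂) hadj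
    exact ⟨r + 1 - φ s(K₁, K₂), ⟨by lia, by lia⟩, (cutPair S₁ S₂ K₁ K₂, sInf (σ '' S)),
      by simp [cutPair], hsplit.isSubpair_cutPair hu hv h₁ h₂⟩

lemma exists_of_connected [Finite (MaxClique H)] (hT : T.IsAcyclic) (φ : Sym2 (MaxClique H) → ℕ)
    (σ : MaxClique H → ℕ) (r : ℕ) (S : Set (MaxClique H)) (hS : (T.induce S).Connected) :
    ∃ d, FindBiclique T φ σ r S d := by
  induction hn : S.ncard using Nat.strong_induction_on generalizing S with
  | _ n ih =>
    subst hn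
    rcases S.subsingleton_or_nontrivial with hsub | hnt
    · exact ⟨_, FindBiclique.small S hsub⟩
    let edges : Set (MaxClique H × MaxClique H) := {e | e.1 ∈ S ∧ e.2 ∈ S ∧ T.Adj e.1 e.2}
    have hedges : edges.Nonempty := by
      have : Nontrivial S := hnt.coe_sort
      obtain ⟨K⟩ := hS.nonempty
      obtain ⟨K', hadj⟩ := hS.preconnected.exists_adj_of_nontrivial K
      exact ⟨(K, K'), K.2, K'.2, hadj⟩
    obtain ⟨⟨K₁, K₂⟩, ⟨h₁, h₂, hadj⟩, hmax⟩ :=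
      Set.exists_max_image edges (fun e => φ s(e.1, e.2)) (Set.toFinite _) hedges
    obtain ⟨S₁, S₂, hsplit⟩ := exists_isSplit hT hS h₁ h₂ hadj
    have hlt₁ : S₁.ncard < S.ncard := Set.ncard_lt_ncard
      ⟨hsplit.subset_left, fun h => Set.disjoint_left.1 hsplit.disjoint (h h₂) hsplit.right_mem⟩
    have hlt₂ : S₂.ncard < S.ncard := Set.ncard_lt_ncard
      ⟨hsplit.subset_right, fun h => Set.disjoint_left.1 hsplit.disjoint hsplit.left_mem (h h₁)⟩
    obtain ⟨d₁, hd₁⟩ := ih _ hlt₁ S₁ hsplit.connected_left rfl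
    obtain ⟨d₂, hd₂⟩ := ih _ hlt₂ S₂ hsplit.connected_right rfl
    exact ⟨_, FindBiclique.cut S S₁ S₂ K₁ K₂ d₁ d₂ hnt hsplit.union_eq hsplit.disjoint
      hsplit.connected_left hsplit.connected_right hsplit.left_mem hsplit.right_mem hadj
      (fun K hK K' hK' h => hmax (K, K') ⟨hK, hK', h⟩) hd₁ hd₂⟩

end FindBiclique

end Cuts

section Merging

variable {V : Type*} {G : SimpleGraph V} {T : SimpleGraph (MaxClique Gᶜ)} {a b : MaxClique Gᶜ}
  {σ : MaxClique Gᶜ → ℕ} {L R L' R' : Set V} {B B' : Set V × Set V}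

namespace IsCliqueTree

lemma adj_of_mem_cliqueUnion_side (hT : IsCliqueTree Gᶜ T) (h2 : AtMostTwoCliques Gᶜ)
    (hab : T.Adj a b) {x y : V} (hx : x ∈ cliqueUnion (side T a b))
    (hy : y ∈ cliqueUnion (side T b a)) (hxy : x ∉ a.1 ∨ y ∉ b.1) : G.Adj x y := by
  refine adj_iff_forall_maxClique.2 fun K hxK hyK => ?_
  obtain ⟨hxa, hyb⟩ := hT.mem_ends_of_mem_of_mem h2 hab hx hy hxK hyK
  exact hxy.elim (· hxa) (· hyb)

lemma isBiclique_union (hT : IsCliqueTree Gᶜ T) (h2 : AtMostTwoCliques Gᶜ) (hab : T.Adj a b)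
    (hB : IsBiclique G L R) (hB' : IsBiclique G L' R') (hside : L ∪ R ⊆ cliqueUnion (side T a b))
    (hside' : L' ∪ R' ⊆ cliqueUnion (side T b a)) (hLR' : Disjoint a.1 L ∨ Disjoint b.1 R')
    (hRL' : Disjoint a.1 R ∨ Disjoint b.1 L') : IsBiclique G (L ∪ L') (R ∪ R') := by
  rw [Set.union_subset_iff] at hside hside'
  refine hB.union hB' (fun x hx y hy => ?_) (fun y hy x hx => SimpleGraph.Adj.symm ?_)
  · exact hT.adj_of_mem_cliqueUnion_side h2 hab (hside.1 hx) (hside'.2 hy)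
      (hLR'.imp (Set.disjoint_right.1 · hx) (Set.disjoint_right.1 · hy))
  · exact hT.adj_of_mem_cliqueUnion_side h2 hab (hside.2 hx) (hside'.1 hy)
      (hRL'.imp (Set.disjoint_right.1 · hx) (Set.disjoint_right.1 · hy))

lemma mergeable (hT : IsCliqueTree Gᶜ T) (h2 : AtMostTwoCliques Gᶜ) (hab : T.Adj a b)
    (hB : IsBiclique G B.1 B.2) (hB' : IsBiclique G B'.1 B'.2)
    (hside : B.1 ∪ B.2 ⊆ cliqueUnion (side T a b))
    (hside' : B'.1 ∪ B'.2 ⊆ cliqueUnion (side T b a)) : Mergeable G B B' := by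
  have hsame := hT.isBiclique_union h2 hab hB hB' hside hside'
  have hswap := hT.isBiclique_union h2 hab hB.symm hB' (Set.union_comm B.1 B.2 ▸ hside) hside'
  rcases hB.disjoint_left_or_right a.2.prop with ha | ha <;>
    rcases hB'.disjoint_left_or_right b.2.prop with hb | hb
  · exact Or.inl (hsame (Or.inl ha) (Or.inr hb))
  · exact Or.inr (hswap (Or.inr hb) (Or.inl ha))
  · exact Or.inr (hswap (Or.inl ha) (Or.inr hb))
  · exact Or.inl (hsame (Or.inr hb) (Or.inl ha))

end IsCliqueTree

namespace Mergeable

lemma isBiclique_mergeInto (h : Mergeable G B B') :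
    IsBiclique G (mergeInto G B B').1 (mergeInto G B B').2 := by
  unfold mergeInto
  split_ifs with hsame hswap
  exacts [hsame, hswap, absurd h (not_or.2 ⟨hsame, hswap⟩)]

lemma mergeInto_eq_or (h : Mergeable G B B') :
    mergeInto G B B' = B ⊔ B' ∨ mergeInto G B B' = B.swap ⊔ B' := by
  unfold mergeInto
  split_ifs with hsame hswap
  exacts [Or.inl rfl, Or.inr rfl, absurd h (not_or.2 ⟨hsame, hswap⟩)]

lemma le_mergeInto (h : Mergeable G B B') : B' ≤ mergeInto G B B' := by
  obtain h | h := h.mergeInto_eq_or <;> exact le_sup_right.trans h.ge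

lemma isSubpair_mergeInto (h : Mergeable G B B') : IsSubpair B (mergeInto G B B') :=
  h.mergeInto_eq_or.imp (le_sup_left.trans ·.ge) (le_sup_left.trans ·.ge)

lemma mergeInto_subset (h : Mergeable G B B') :
    (mergeInto G B B').1 ∪ (mergeInto G B B').2 ⊆ (B.1 ∪ B.2) ∪ (B'.1 ∪ B'.2) := by
  obtain h | h := h.mergeInto_eq_or
  · rw [h, Set.union_union_union_comm]; rfl
  · rw [h, Set.union_comm B.1, Set.union_union_union_comm]; rfl

end Mergeable

/-- Every pair `B` in the list, except the first, is separated by an edge of `T` from all pairs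
that precede it: this is what makes a single biclique out of a whole level. -/
def SeparatedFromEarlier (T : SimpleGraph (MaxClique Gᶜ)) (l : List (Set V × Set V)) : Prop :=
  ∀ l' B, l' ++ [B] <+: l → l' ≠ [] → ∃ a b, T.Adj a b ∧
    B.1 ∪ B.2 ⊆ cliqueUnion (side T a b) ∧
      ∀ B' ∈ l', B'.1 ∪ B'.2 ⊆ cliqueUnion (side T b a)

lemma foldl_mergeRound_eq_singleton (hT : IsCliqueTree Gᶜ T) (h2 : AtMostTwoCliques Gᶜ)
    {l : List (Set V × Set V)} (hl : l ≠ []) (hbi : ∀ B ∈ l, IsBiclique G B.1 B.2)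
    (hsep : SeparatedFromEarlier T l) :
    ∃ M, l.foldl (mergeRound G) [] = [M] ∧ IsBiclique G M.1 M.2 ∧
      M.1 ∪ M.2 ⊆ ⋃ B ∈ l, B.1 ∪ B.2 ∧ ∀ B ∈ l, IsSubpair B M := by
  induction l using List.reverseRecOn with
  | nil => exact absurd rfl hl
  | append_singleton l B ih =>
    rcases eq_or_ne l [] with rfl | hl
    · exact ⟨B, by simp [mergeRound], hbi B (by simp), by simp,
        fun B' hB' => Or.inl (List.mem_singleton.1 hB').le⟩
    obtain ⟨M, hfold, hM, hMl, hsub⟩ := ih hl (fun B' hB' => hbi B' (List.mem_append_left _ hB'))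
      fun l' B' hpre => hsep l' B' (hpre.trans (List.prefix_append _ _))
    obtain ⟨a, b, hab, hBa, hlb⟩ := hsep l B List.prefix_rfl hl
    have hmerge : Mergeable G B M := hT.mergeable h2 hab (hbi B (by simp)) hM hBa
      (hMl.trans (Set.iUnion₂_subset hlb))
    refine ⟨mergeInto G B M, by simp [hfold, mergeRound, hmerge], hmerge.isBiclique_mergeInto,
      ?_, ?_⟩
    · refine hmerge.mergeInto_subset.trans (Set.union_subset ?_ (hMl.trans ?_))
      · exact Set.subset_biUnion_of_mem (u := fun B : Set V × Set V => B.1 ∪ B.2)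
          (List.mem_append_right l (List.mem_singleton_self B))
      · exact Set.biUnion_subset_biUnion_left fun B' hB' => List.mem_append_left _ hB'
    · intro B' hB'
      rcases List.mem_append.1 hB' with hB' | hB'
      · exact (hsub B' hB').trans_le hmerge.le_mergeInto
      · exact List.mem_singleton.1 hB' ▸ hmerge.isSubpair_mergeInto

lemma separatedFromEarlier_map_fst {ρ : MaxClique Gᶜ} (hσ : IsSearchOrdering T ρ σ)
    {l : List (Entry V)} (hcuts : l.Pairwise (DisjointCuts T σ))
    (hsorted : l.Pairwise fun E E' => E.2 ≤ E'.2) :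
    SeparatedFromEarlier T (l.map Prod.fst) := by
  intro l' B hpre hne
  obtain ⟨m, hm, hmap⟩ := List.prefix_map_iff.1 hpre
  obtain ⟨l₁, l₂, rfl, rfl, hB⟩ := List.map_eq_append_iff.1 hmap.symm
  obtain ⟨E, rfl, rfl⟩ := List.map_eq_singleton_iff.1 hB
  have hearlier : ∀ E' ∈ l₁, DisjointCuts T σ E' E ∧ E'.2 ≤ E.2 := fun E' hE' =>
    ⟨(List.pairwise_append.1 (hcuts.sublist hm.sublist)).2.2 E' hE' E (by simp),
      (List.pairwise_append.1 (hsorted.sublist hm.sublist)).2.2 E' hE' E (by simp)⟩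
  obtain ⟨E₀, hE₀⟩ := List.exists_mem_of_ne_nil l₁ (by simpa using hne)
  obtain ⟨⟨-, S, -, -, hcut⟩, -⟩ := hearlier E₀ hE₀
  obtain ⟨a, haS, ha⟩ := hcut.exists_mem_eq
  have hexists : ∀ E' ∈ l₁, ∃ S', a ∉ S' ∧ IsCutEntry T σ S' E' ∧ ∃ w ∈ S', σ w < σ a := by
    intro E' hE'
    obtain ⟨⟨S', S'', hdisj, hcut', hcut''⟩, hle⟩ := hearlier E' hE'
    obtain ⟨a', ha'S, ha'⟩ := hcut''.exists_mem_eq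
    obtain rfl := hσ.injective (ha'.trans ha.symm)
    have haS' := Set.disjoint_right.1 hdisj ha'S
    obtain ⟨w, hwS', hw⟩ := hcut'.exists_mem_eq
    have hne : σ w ≠ σ a' := fun h => haS' (hσ.injective h ▸ hwS')
    exact ⟨S', haS', hcut', w, hwS', by lia⟩
  obtain ⟨-, -, -, w₀, -, hw₀⟩ := hexists E₀ hE₀
  obtain ⟨b, hab, hba, hb⟩ := hσ.exists_adj_forall_lt_mem_side hw₀
  have hbS : b ∉ S := fun h => (ha ▸ hcut.le_of_mem h).not_gt hba
  refine ⟨a, b, hab, hcut.subset_cliqueUnion_side haS left_mem_side (Or.inr hbS), ?_⟩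
  intro B' hB'
  obtain ⟨E', hE', rfl⟩ := List.mem_map.1 hB'
  obtain ⟨S', haS', hcut', w, hwS', hw⟩ := hexists E' hE'
  exact hcut'.subset_cliqueUnion_side hwS' (hb w hw) (Or.inr haS')

end Merging

section Algorithm

variable {V : Type*} {G : SimpleGraph V} {T : SimpleGraph (MaxClique Gᶜ)}

lemma exists_mergeBiclique (G : SimpleGraph V) (l : List (Entry V)) : ∃ C, MergeBiclique G l C := by
  let le : Entry V → Entry V → Bool := fun E E' => decide (E.2 ≤ E'.2)
  refine ⟨_, l.mergeSort le, List.mergeSort_perm _ _, ?_, rfl⟩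
  have hsorted := List.pairwise_mergeSort (le := le)
    (fun E E' E'' h h' => decide_eq_true ((of_decide_eq_true h).trans (of_decide_eq_true h')))
    (fun E E' => by simpa [le] using le_total E.2 E'.2) l
  exact hsorted.imp of_decide_eq_true

lemma MergeBiclique.exists_covering {σ : MaxClique Gᶜ → ℕ} {ρ : MaxClique Gᶜ}
    {l : List (Entry V)} {C : List (Set V × Set V)} (h : MergeBiclique G l C)
    (hT : IsCliqueTree Gᶜ T) (h2 : AtMostTwoCliques Gᶜ) (hσ : IsSearchOrdering T ρ σ)
    (hcuts : l.Pairwise (DisjointCuts T σ)) (hbi : ∀ E ∈ l, IsBiclique G E.1.1 E.1.2) :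
    {B | B ∈ C}.Subsingleton ∧ (∀ B ∈ C, IsBiclique G B.1 B.2) ∧
      ∀ E ∈ l, ∃ B ∈ C, IsSubpair E.1 B := by
  obtain ⟨sorted, hperm, hsorted, rfl⟩ := h
  rcases eq_or_ne sorted [] with rfl | hne
  · obtain rfl := hperm.symm.eq_nil
    simp
  obtain ⟨M, hfold, hM, -, hsub⟩ := foldl_mergeRound_eq_singleton hT h2
    (l := sorted.map Prod.fst) (by simpa using hne)
    (List.forall_mem_map.2 fun E hE => hbi E (hperm.subset hE))
    (separatedFromEarlier_map_fst hσ ((hperm.pairwise_iff DisjointCuts.symm).2 hcuts) hsorted)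
  rw [hfold]
  exact ⟨by simp, List.forall_mem_singleton.2 hM, fun E hE =>
    ⟨M, List.mem_singleton_self M, hsub E.1 (List.mem_map_of_mem (hperm.symm.subset hE))⟩⟩

namespace RunOn

variable {C : Set (Sym2 (Set V))}

lemma exists_levels (h : RunOn G T C) (h2 : AtMostTwoCliques Gᶜ) :
    ∃ M : ℕ → List (Set V × Set V),
      C = {B | ∃ i ∈ Set.Icc 1 (edgeRankingNumber T), ∃ L R, (L, R) ∈ M i ∧ B = s(L, R)} ∧
      (∀ i ∈ Set.Icc 1 (edgeRankingNumber T), {B | B ∈ M i}.Subsingleton) ∧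
      (∀ i ∈ Set.Icc 1 (edgeRankingNumber T), ∀ B ∈ M i, IsBiclique G B.1 B.2) ∧
      ∀ u v, G.Adj u v →
        ∃ i ∈ Set.Icc 1 (edgeRankingNumber T), ∃ B ∈ M i, IsSubpair ({u}, {v}) B := by
  obtain ⟨hT, r, φ, σ, d, M, rfl, hφ, hσ, hd, hM, rfl⟩ := h
  obtain ⟨ρ, hσ⟩ := hσ.exists_isSearchOrdering hT.1.connected
  have hlevel i hi := (hM i hi).exists_covering hT h2 hσ (hd.pairwise_disjointCuts hφ i)
    fun E hE => by
      obtain ⟨S, -, hcut⟩ := hd.exists_isCutEntry hE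
      exact hcut.isBiclique hT
  refine ⟨M, rfl, fun i hi => (hlevel i hi).1, fun i hi => (hlevel i hi).2.1, fun u v huv => ?_⟩
  have huniv (x : V) : x ∈ cliqueUnion (Set.univ : Set (MaxClique Gᶜ)) := by
    obtain ⟨K, hK⟩ := exists_maxClique_superset (Gᶜ.isClique_singleton x)
    exact mem_cliqueUnion.2 ⟨K, Set.mem_univ K, hK rfl⟩
  obtain ⟨i, hi, E, hE, hsub⟩ :=
    hd.exists_isSubpair hφ (adj_iff_forall_maxClique.1 huv) (huniv u) (huniv v)
  obtain ⟨B, hB, hEB⟩ := (hlevel i hi).2.2 E hE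
  exact ⟨i, hi, B, hB, hsub.trans hEB⟩

lemma isBicliqueCover (h : RunOn G T C) (h2 : AtMostTwoCliques Gᶜ) : IsBicliqueCover G C := by
  obtain ⟨M, rfl, -, hbi, hcover⟩ := h.exists_levels h2
  refine ⟨?_, fun u v huv => ?_⟩
  · rintro L R ⟨i, hi, L', R', hmem, heq⟩
    obtain ⟨rfl, rfl⟩ | ⟨rfl, rfl⟩ := Sym2.eq_iff.1 heq
    exacts [hbi i hi _ hmem, (hbi i hi _ hmem).symm]
  · obtain ⟨i, hi, ⟨L, R⟩, hmem, ⟨hu, hv⟩ | ⟨hv, hu⟩⟩ := hcover u v huv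
    · exact ⟨L, R, ⟨i, hi, L, R, hmem, rfl⟩, hu rfl, hv rfl⟩
    · exact ⟨R, L, ⟨i, hi, L, R, hmem, Sym2.eq_swap⟩, hu rfl, hv rfl⟩

lemma encard_le (h : RunOn G T C) (h2 : AtMostTwoCliques Gᶜ) : C.encard ≤ edgeRankingNumber T := by
  obtain ⟨M, rfl, hsub, -, -⟩ := h.exists_levels h2
  set r := edgeRankingNumber T
  let level (i : ℕ) : Set (Sym2 (Set V)) := {B | ∃ L R, (L, R) ∈ M i ∧ B = s(L, R)}
  have hlevel : ∀ i ∈ Finset.Icc 1 r, (level i).encard ≤ 1 := by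
    intro i hi
    refine Set.encard_le_one_iff_subsingleton.2 ?_
    rintro _ ⟨L, R, hmem, rfl⟩ _ ⟨L', R', hmem', rfl⟩
    obtain ⟨rfl, rfl⟩ := Prod.mk.inj (hsub i (Finset.mem_Icc.1 hi) hmem hmem')
    rfl
  calc {B | ∃ i ∈ Set.Icc 1 r, B ∈ level i}.encard
      = (⋃ i ∈ Finset.Icc 1 r, level i).encard := by
        congr 1
        ext B
        simp
    _ ≤ ∑ i ∈ Finset.Icc 1 r, (level i).encard := Finset.set_encard_biUnion_le _ _
    _ ≤ ∑ i ∈ Finset.Icc 1 r, 1 := Finset.sum_le_sum hlevel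
    _ = r := by simp

lemma isMinimumBicliqueCover (h : RunOn G T C) (h2 : AtMostTwoCliques Gᶜ)
    (hr : edgeRankingNumber T = ⌈Real.logb 2 (mc Gᶜ)⌉₊) : IsMinimumBicliqueCover G C :=
  (h.isBicliqueCover h2).isMinimumBicliqueCover (hr ▸ h.encard_le h2)

end RunOn

lemma exists_runOn [Finite (MaxClique Gᶜ)] (hT : IsCliqueTree Gᶜ T) : ∃ C, RunOn G T C := by
  obtain ⟨φ, hφ⟩ := exists_isEdgeRanking_edgeRankingNumber T
  obtain ⟨σ, hσ⟩ := exists_isBFSOrdering hT.1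
  obtain ⟨d, hd⟩ := FindBiclique.exists_of_connected hT.1.isAcyclic φ σ (edgeRankingNumber T)
    Set.univ ((SimpleGraph.induceUnivIso T).connected_iff.2 hT.1.connected)
  choose M hM using fun i => exists_mergeBiclique G (d i)
  exact ⟨_, hT, _, φ, σ, d, M, rfl, hφ, hσ, hd, fun i _ => hM i, rfl⟩

end Algorithm

end BicliqueCover

open BicliqueCover in
theorem mainTheorem6 {V : Type*} [Finite V] (G : SimpleGraph V)
    (hchordal : BicliqueCover.IsChordal Gᶜ)
    (htwo : ∀ v : V, {I : Set V | Maximal G.IsIndepSet I ∧ v ∈ I}.ncard ≤ 2)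
    (htree : ∃ T : SimpleGraph (BicliqueCover.MaxClique Gᶜ), BicliqueCover.IsCliqueTree Gᶜ T ∧
      BicliqueCover.edgeRankingNumber T = ⌈Real.logb 2 (BicliqueCover.mc Gᶜ)⌉₊) :
    BicliqueCover.bc G = ⌈Real.logb 2 (BicliqueCover.mc Gᶜ)⌉₊ ∧
    (∀ T : SimpleGraph (BicliqueCover.MaxClique Gᶜ), BicliqueCover.IsCliqueTree Gᶜ T →
      BicliqueCover.edgeRankingNumber T = ⌈Real.logb 2 (BicliqueCover.mc Gᶜ)⌉₊ →
      (∃ C, BicliqueCover.RunOn G T C) ∧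
        ∀ C, BicliqueCover.RunOn G T C → BicliqueCover.IsMinimumBicliqueCover G C) ∧
    (Gᶜ.Connected →
      (∃ C, BicliqueCover.Run G C) ∧
        ∀ C, BicliqueCover.Run G C → BicliqueCover.IsMinimumBicliqueCover G C) := by
  have h2 := atMostTwoCliques_compl htwo
  obtain ⟨T₀, hT₀, hr₀⟩ := htree
  obtain ⟨C₀, hC₀⟩ := exists_runOn hT₀
  have hbc : bc G = ⌈Real.logb 2 (mc Gᶜ)⌉₊ :=
    (hC₀.isBicliqueCover h2).bc_eq (hr₀ ▸ hC₀.encard_le h2)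
  refine ⟨hbc, fun T hT hr => ?_, fun hconn => ?_⟩
  · exact ⟨exists_runOn hT, fun C hC => hC.isMinimumBicliqueCover h2 hr⟩
  · refine ⟨⟨C₀, T₀, hC₀⟩, fun C hrun => ?_⟩
    obtain ⟨T, hC⟩ := hrun
    obtain rfl : T = T₀ := hC.1.eq hT₀ h2 hconn
    exact hC.isMinimumBicliqueCover h2 hr₀
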